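/- Let $\mathbb{D}=\{z\in\mathbb{C}:|z|<1\}$ and $\mathbb{T}=\partial\mathbb{D}$. A meromorphic function $F$ on $\mathbb{D}$ is called a pseudo-Carathéodory function if (i) $F$ is the ratio of two bounded analytic functions in $\mathbb{D}$ (the denominator not identically zero), and (ii) $\operatorname{Re}F\ge 0$ almost everywhere on $\mathbb{T}$, where the boundary values of $F$ are its radial limits (which exist almost everywhere). For a pseudo-Carathéodory function $F$, not identically zero, put $$f_0(z)=\frac1z\,\frac{F(z)-F(0)}{F(z)+F(0)}$$ ($f_0(z)=-1/z$ if $F$ has a pole at $0$), and, as long as $0$ is not a pole of $f_n$ and $1-\overline{f_n(0)}f_n\not\equiv 0$, put $$f_{n+1}(z)=\frac1z\cdot\frac{f_n(z)-f_n(0)}{1-\overline{f_n(0)}\,f_n(z)},\qquad n=0,1,2,\dots$$ We say that $F$ determines the sequence $\{\alpha_n\}_{n=0}^\infty$ if $f_n$ is defined, $0$ is not a pole of $f_n$, and $f_n(0)=\alpha_n$, for all $n\ge 0$. **Theorem.** Let $\{\alpha_n\}_{n=0}^\infty$ be a sequence of complex numbers for which there is a natural number $N$ with $|\alpha_n|\ne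 1$ for $0\le n\le N-1$ and $|\alpha_n|<1$ for $n\ge N$. Then there is a pseudo-Carathéodory function $F_*$ that determines $\{\alpha_n\}_{n=0}^\infty$. If $G_*$ is another pseudo-Carathéodory function that determines $\{\alpha_n\}_{n=0}^\infty$, then $G_*$ is a scalar multiple of $F_*$, that is, $G_*=cF_*$ in $\mathbb{D}$ for some $c\in\mathbb{C}$. -/

import Mathlib

open Filter Topology MeasureTheory ComplexConjugate

noncomputable section

/-- The open unit disk. -/
def unitDisk : Set ℂ := Metric.ball (0 : ℂ) 1

/-- `g` is a bounded analytic function in the open unit disk. -/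
def IsBoundedAnalytic (g : ℂ → ℂ) : Prop :=
  AnalyticOnNhd ℂ g unitDisk ∧ ∃ C : ℝ, ∀ z ∈ unitDisk, ‖g z‖ ≤ C

/-- `F` is a pseudo-Carathéodory function.

A meromorphic function in the disk is represented by its normal form: at a point which is not a
pole it takes its true value (removable singularities are removed), and at a pole it takes the
value `0`. In this way two meromorphic functions in the disk are equal if and only if their
representatives agree at every point of the disk. Only the values in the disk matter. -/
structure IsPseudoCaratheodory (F : ℂ → ℂ) : Prop where
  meromorphicNFOn : MeromorphicNFOn F unitDisk
  /-- `F` is the ratio of two bounded analytic functions in the disk. -/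
  ratio : ∃ g h : ℂ → ℂ, IsBoundedAnalytic g ∧ IsBoundedAnalytic h ∧
    (∃ z ∈ unitDisk, h z ≠ 0) ∧ ∀ z ∈ unitDisk, h z ≠ 0 → F z = g z / h z
  /-- At almost every point of the unit circle the boundary value (radial limit) of `F` exists
  and has a nonnegative real part. -/
  re_nonneg : ∀ᵐ θ : ℝ, ∃ w : ℂ,
    Tendsto (fun r : ℝ => F (r * Complex.exp (θ * Complex.I))) (𝓝[<] 1) (𝓝 w) ∧ 0 ≤ w.re

open Classical in
/-- The function `f₀(z) = (1/z) (F(z) - F(0)) / (F(z) + F(0))`, as a meromorphic function in the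
disk (in normal form); it is `-1/z` if `F` has a pole at `0`. -/
def schurSeed (F : ℂ → ℂ) : ℂ → ℂ :=
  if meromorphicOrderAt F 0 < 0 then fun z => -1 / z
  else toMeromorphicNFOn (fun z => 1 / z * ((F z - F 0) / (F z + F 0))) unitDisk

/-- One step of the inverse Schur recursion,
`f ↦ (1/z) (f(z) - f(0)) / (1 - conj (f(0)) f(z))`, as a meromorphic function in the disk
(in normal form). -/
def schurStep (f : ℂ → ℂ) : ℂ → ℂ :=
  toMeromorphicNFOn (fun z => 1 / z * ((f z - f 0) / (1 - conj (f 0) * f z))) unitDisk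

/-- The sequence `f₀, f₁, f₂, …` obtained from `F` by the inverse Schur recursion. -/
def schurIterate (F : ℂ → ℂ) : ℕ → ℂ → ℂ
  | 0 => schurSeed F
  | n + 1 => schurStep (schurIterate F n)

/-- `F` determines, via the inverse Schur recursion, a sequence `f₀, f₁, f₂, …` with
`fₙ(0) = α n` for all `n`: no denominator vanishes identically (so that every `fₙ` is defined as a
meromorphic function), `0` is not a pole of any `fₙ`, and the values at `0` are the given ones. -/
structure DeterminesSchurParameters (F : ℂ → ℂ) (α : ℕ → ℂ) : Prop where
  seed_defined : ∃ z ∈ unitDisk, F z + F 0 ≠ 0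
  step_defined : ∀ n, ∃ z ∈ unitDisk, 1 - conj (schurIterate F n 0) * schurIterate F n z ≠ 0
  not_pole : ∀ n, AnalyticAt ℂ (schurIterate F n) 0
  value : ∀ n, schurIterate F n 0 = α n

end

/-! Existence. If every parameter lies in the open disk, Schur's algorithm gives functions `s n`
bounded by one with these parameters (`exists_schur_functions`). A finite initial segment off the
unit circle is then prepended one parameter at a time to a fraction `P / Q` of bounded analytic
functions, by (P, Q) ↦ (aQ + zP, Q + āzP). By `normSq_moebius_sub`, on the circle this multiplies
|Q|² - |P|² by 1 - |a|², so its sign may flip, but it flips at almost every point at once. Hence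
ε(|Q|² - |P|²) ≥ 0 a.e. for one constant sign ε. Put F = ε(Q + zP)/(Q - zP). Then Re F = ε(|Q|² -
|P|²)/|Q - zP|² on the circle, and the seed f₀ of F is P/Q. The factor ε does not affect f₀, which
is invariant under scaling of F; it only makes the real part nonnegative. For the boundary values of
F to exist, P and Q need radial limits a.e. (Fatou's theorem, `ae_exists_radial_limit`) and the
limit of Q - zP must be nonzero a.e. (Jensen's formula, `ae_not_tendsto_radial_zero`).

Uniqueness. If two functions determine the same parameters, the difference of their n-th iterates
vanishes at 0 to order at least one more than the difference of the next ones, because |α n| ≠ 1.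
All these orders are therefore infinite and the iterates agree near 0. The seed and F(0) give back F
= F(0)(1 + zf₀)/(1 - zf₀), so the two functions are proportional near 0, and in the disk by the
identity theorem. -/

/-! ### Radial limits of bounded analytic functions -/

/-- The Poisson kernel has mean one. The two error terms serve two arcs: where `f` is small, `ε`
absorbs it; where only the kernel is small, `K` does. -/
theorem norm_le_of_poissonKernel_mul_norm_le {f : ℂ → ℂ} {w : ℂ} {ε K : ℝ}
    (hf : DiffContOnCl ℂ f (Metric.ball 0 1)) (hw : w ∈ Metric.ball (0 : ℂ) 1)
    (h : ∀ ζ : ℂ, ‖ζ‖ = 1 →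
      poissonKernel 0 w ζ * ‖f ζ‖ ≤ poissonKernel 0 w ζ * ε + K) :
    ‖f w‖ ≤ ε + K := by
  have hw' : ‖w‖ < 1 := by simpa using hw
  have hne : ∀ θ : ℝ, ‖circleMap 0 1 θ - w‖ ≠ 0 := by
    intro θ h0
    rw [norm_eq_zero, sub_eq_zero] at h0
    rw [← h0] at hw'
    simp at hw'
  have hcont : Continuous fun θ : ℝ => poissonKernel 0 w (circleMap 0 1 θ) := by
    unfold poissonKernel
    simp only [sub_zero]
    refine Continuous.div (by fun_prop) (by fun_prop) fun θ => pow_ne_zero 2 (hne θ)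
  have hnonneg : ∀ θ : ℝ, 0 ≤ poissonKernel 0 w (circleMap 0 1 θ) := by
    intro θ
    unfold poissonKernel
    refine div_nonneg ?_ (by positivity)
    simp only [sub_zero, norm_circleMap_zero, abs_one, one_pow, sub_nonneg]
    nlinarith [norm_nonneg w]
  have h1 := hf.circleAverage_poissonKernel_smul hw
  have h2 : Real.circleAverage (poissonKernel 0 w • fun _ : ℂ => (1 : ℂ)) 0 1 = 1 :=
    (diffContOnCl_const (c := (1 : ℂ))).circleAverage_poissonKernel_smul hw
  rw [Real.circleAverage_def] at h1 h2
  have h3 : ∫ θ in (0 : ℝ)..2 * Real.pi, poissonKernel 0 w (circleMap 0 1 θ) = 2 * Real.pi := by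
    simp only [Pi.smul_apply', Complex.real_smul, mul_one] at h2
    rw [intervalIntegral.integral_ofReal] at h2
    have : (2 * Real.pi)⁻¹ * ∫ θ in (0 : ℝ)..2 * Real.pi, poissonKernel 0 w (circleMap 0 1 θ) = 1 := by
      exact_mod_cast h2
    field_simp at this
    linarith
  rw [← h1, norm_smul, Real.norm_of_nonneg (by positivity)]
  have h4 : ‖∫ θ in (0 : ℝ)..2 * Real.pi, (poissonKernel 0 w • f) (circleMap 0 1 θ)‖ ≤
      ∫ θ in (0 : ℝ)..2 * Real.pi, (poissonKernel 0 w (circleMap 0 1 θ) * ε + K) := by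
    refine intervalIntegral.norm_integral_le_of_norm_le (by positivity) ?_ ?_
    · refine Eventually.of_forall fun θ _ => ?_
      rw [Pi.smul_apply', norm_smul, Real.norm_of_nonneg (hnonneg θ)]
      exact h _ (by simp)
    · exact (Continuous.intervalIntegrable (by fun_prop) _ _)
  rw [intervalIntegral.integral_add (Continuous.intervalIntegrable (by fun_prop) _ _)
    (by simp), intervalIntegral.integral_mul_const, h3] at h4
  simp only [intervalIntegral.integral_const, sub_zero, smul_eq_mul] at h4
  calc _ ≤ (2 * Real.pi)⁻¹ * (2 * Real.pi * ε + 2 * Real.pi * K) := by gcongr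
    _ = ε + K := by field_simp

theorem hasDerivAt_exp_ofReal_mul_I (θ : ℝ) :
    HasDerivAt (fun θ : ℝ => Complex.exp (θ * Complex.I))
      (Complex.exp (θ * Complex.I) * Complex.I) θ := by
  simpa using (((hasDerivAt_id θ).ofReal_comp).mul_const Complex.I).cexp

theorem exists_deriv_along_circle {G : ℂ → ℂ} {θ₀ : ℝ}
    (h : DifferentiableAt ℝ (fun θ : ℝ => G (Complex.exp (θ * Complex.I))) θ₀) :
    ∃ A : ℂ, ∀ ε > 0, ∃ δ > 0, ∀ ζ : ℂ, ‖ζ‖ = 1 → ‖ζ - Complex.exp (θ₀ * Complex.I)‖ < δ →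
      ‖G ζ - G (Complex.exp (θ₀ * Complex.I)) - A * (ζ - Complex.exp (θ₀ * Complex.I))‖ ≤
        ε * ‖ζ - Complex.exp (θ₀ * Complex.I)‖ := by
  set ζ₀ := Complex.exp (θ₀ * Complex.I) with hζ₀
  have hζ₀n : ‖ζ₀‖ = 1 := Complex.norm_exp_ofReal_mul_I θ₀
  have hζ₀0 : ζ₀ ≠ 0 := Complex.exp_ne_zero _
  obtain ⟨B, hB⟩ : ∃ B, HasDerivAt (fun θ : ℝ => G (Complex.exp (θ * Complex.I))) B θ₀ :=
    ⟨_, h.hasDerivAt⟩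
  have hE : HasDerivAt (fun θ : ℝ => Complex.exp (θ * Complex.I)) (ζ₀ * Complex.I) θ₀ :=
    hasDerivAt_exp_ofReal_mul_I θ₀
  -- Chain rule: dζ/dθ = iζ. The factor π/2 below bounds arc length by chord length.
  refine ⟨B / (ζ₀ * Complex.I), fun ε hε => ?_⟩
  have hD : HasDerivAt (fun θ : ℝ => G (Complex.exp (θ * Complex.I)) -
      B / (ζ₀ * Complex.I) * Complex.exp (θ * Complex.I)) 0 θ₀ := by
    have := hB.sub (hE.const_mul (B / (ζ₀ * Complex.I)))
    rwa [div_mul_cancel₀ _ (mul_ne_zero hζ₀0 Complex.I_ne_zero), sub_self] at this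
  have hlo := hasDerivAt_iff_isLittleO.1 hD
  have hev := hlo.def (c := ε / (Real.pi / 2)) (by positivity)
  obtain ⟨δ, hδ, hball⟩ := Metric.eventually_nhds_iff.1 hev
  refine ⟨δ / (Real.pi / 2), by positivity, fun ζ hζ hd => ?_⟩
  set u := ζ / ζ₀ with hu
  have hun : ‖u‖ = 1 := by simp [hu, hζ, hζ₀n]
  have hu0 : u ≠ 0 := by rw [← norm_ne_zero_iff, hun]; norm_num
  have harg : |u.arg| ≤ Real.pi / 2 * ‖ζ - ζ₀‖ := by
    have h1 := Complex.angle_le_mul_norm_sub (x := 1) (y := u) (by simp) hun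
    rw [Complex.angle_one_left hu0] at h1
    have : ‖1 - u‖ = ‖ζ - ζ₀‖ := by
      have : ζ - ζ₀ = -(1 - u) * ζ₀ := by rw [hu]; field_simp; ring
      rw [this, norm_mul, norm_neg, hζ₀n, mul_one]
    rwa [this] at h1
  have hexp : Complex.exp (((θ₀ + u.arg : ℝ) : ℂ) * Complex.I) = ζ := by
    rw [Complex.ofReal_add, add_mul, Complex.exp_add, ← hζ₀]
    have := Complex.norm_mul_exp_arg_mul_I u
    rw [hun, Complex.ofReal_one, one_mul] at this
    rw [this, hu]
    field_simp
  have := hball (y := θ₀ + u.arg) (by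
    rw [Real.dist_eq, add_sub_cancel_left]
    refine harg.trans_lt ?_
    rw [lt_div_iff₀ (by positivity)] at hd
    linarith)
  rw [hexp, ← hζ₀] at this
  simp only [smul_zero, sub_zero, add_sub_cancel_left, Real.norm_eq_abs] at this
  calc _ = ‖G ζ - B / (ζ₀ * Complex.I) * ζ - (G ζ₀ - B / (ζ₀ * Complex.I) * ζ₀)‖ := by
        congr 1; ring
    _ ≤ ε / (Real.pi / 2) * |u.arg| := this
    _ ≤ ε / (Real.pi / 2) * (Real.pi / 2 * ‖ζ - ζ₀‖) := by gcongr
    _ = ε * ‖ζ - ζ₀‖ := by field_simp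

theorem norm_sub_le_norm_sub_mul {ζ ζ₀ : ℂ} {t : ℝ} (hζ : ‖ζ‖ ≤ 1) (hζ₀ : ‖ζ₀‖ = 1) (ht : 1 ≤ t) :
    ‖ζ - ζ₀‖ ≤ ‖ζ - t * ζ₀‖ := by
  have h1 : (ζ * conj ζ₀).re ≤ 1 := by
    refine (Complex.re_le_norm _).trans ?_
    rw [norm_mul, RCLike.norm_conj, hζ₀, mul_one]
    exact hζ
  refine le_of_sq_le_sq ?_ (norm_nonneg _)
  rw [← Complex.normSq_eq_norm_sq, ← Complex.normSq_eq_norm_sq, Complex.normSq_sub,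
    Complex.normSq_sub, Complex.normSq_mul, Complex.normSq_eq_norm_sq ζ₀, hζ₀]
  have h2 : (ζ * conj ((t : ℂ) * ζ₀)).re = t * (ζ * conj ζ₀).re := by
    rw [map_mul, Complex.conj_ofReal, ← mul_assoc, mul_comm ζ, mul_assoc, Complex.re_ofReal_mul]
  rw [h2]
  simp only [Complex.normSq_ofReal]
  nlinarith

/-- With s = 1 - r, a Poisson estimate makes Φ at most εs/4 on the circle of radius s/2 about rζ₀,
and Cauchy's estimate then bounds the derivative at the centre by ε/2. -/
theorem tendsto_deriv_radial_of_isLittleO_boundary {Φ : ℂ → ℂ} {ζ₀ : ℂ} {L : ℝ}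
    (hΦ : DiffContOnCl ℂ Φ (Metric.ball 0 1)) (hζ₀ : ‖ζ₀‖ = 1) (hL : 0 ≤ L)
    (hlip : ∀ ζ : ℂ, ‖ζ‖ = 1 → ‖Φ ζ‖ ≤ L * ‖ζ - ζ₀‖)
    (hlo : ∀ ε > 0, ∃ δ > 0, ∀ ζ : ℂ, ‖ζ‖ = 1 → ‖ζ - ζ₀‖ < δ → ‖Φ ζ‖ ≤ ε * ‖ζ - ζ₀‖) :
    Tendsto (fun r : ℝ => deriv Φ (r * ζ₀)) (𝓝[<] 1) (𝓝 0) := by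
  rw [Metric.tendsto_nhds]
  intro ε hε
  obtain ⟨δ, hδ, hnear⟩ := hlo (ε / 20) (by positivity)
  have hev : ∀ᶠ r : ℝ in 𝓝[<] 1, 0 < r ∧ 3 * (1 - r) ≤ δ ∧ 12 * L * (1 - r) ≤ ε / 20 * δ ^ 2 := by
    refine Filter.Eventually.filter_mono nhdsWithin_le_nhds ?_
    refine ((lt_mem_nhds one_pos).and (Eventually.and ?_ ?_))
    · have : Tendsto (fun r : ℝ => 3 * (1 - r)) (𝓝 1) (𝓝 (3 * (1 - 1))) :=
        Continuous.tendsto (by fun_prop) 1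
      exact this.eventually (ge_mem_nhds (by simpa using hδ))
    · have : Tendsto (fun r : ℝ => 12 * L * (1 - r)) (𝓝 1) (𝓝 (12 * L * (1 - 1))) :=
        Continuous.tendsto (by fun_prop) 1
      exact this.eventually (ge_mem_nhds (by simp; positivity))
  filter_upwards [hev, self_mem_nhdsWithin] with r ⟨hr0, hr1, hr2⟩ hr
  have hs : 0 < 1 - r := by simpa using hr
  set s := 1 - r with hsdef
  have hr' : r = 1 - s := by ring
  have hnr : ‖(r : ℂ) * ζ₀‖ = r := by
    rw [norm_mul, hζ₀, mul_one, Complex.norm_real, Real.norm_of_nonneg hr0.le]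
  have hball : Metric.closedBall ((r : ℂ) * ζ₀) (s / 2) ⊆ Metric.ball 0 1 := by
    intro w hw
    rw [mem_closedBall_iff_norm] at hw
    rw [mem_ball_zero_iff]
    have : ‖w‖ ≤ ‖w - r * ζ₀‖ + ‖(r : ℂ) * ζ₀‖ := by
      simpa using norm_add_le (w - r * ζ₀) (r * ζ₀)
    linarith
  have key : ∀ w ∈ Metric.sphere ((r : ℂ) * ζ₀) (s / 2), ‖Φ w‖ ≤ 5 * s * (ε / 20) := by
    intro w hw
    have hwb := hball (Metric.sphere_subset_closedBall hw)
    rw [mem_sphere_iff_norm] at hw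
    have hw1 : ‖w‖ < 1 := by simpa using hwb
    have hwlow : 1 - 3 / 2 * s ≤ ‖w‖ := by
      have : ‖(r : ℂ) * ζ₀‖ ≤ ‖w - r * ζ₀‖ + ‖w‖ := by
        have := norm_sub_le w (w - r * ζ₀)
        rw [sub_sub_cancel] at this
        linarith
      linarith
    have hne : ∀ z : ℂ, ‖z‖ ≤ 1 → z - ((1 + s : ℝ) : ℂ) * ζ₀ ≠ 0 := by
      intro z hz h0
      rw [sub_eq_zero] at h0
      rw [h0, norm_mul, hζ₀, mul_one, Complex.norm_real, Real.norm_of_nonneg (by linarith)] at hz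
      linarith
    -- Dividing by the distance to a point just outside the disk turns the bounds on Φ into bounds
    -- on a quotient: at most ε/20 near ζ₀, and at most L elsewhere, where the Poisson kernel is
    -- O(s).
    have hφ : DiffContOnCl ℂ (fun z => Φ z * (z - ((1 + s : ℝ) : ℂ) * ζ₀)⁻¹) (Metric.ball 0 1) := by
      refine DiffContOnCl.smul hΦ (DiffContOnCl.inv (Differentiable.diffContOnCl (by fun_prop)) ?_)
      intro z hz
      rw [closure_ball _ one_ne_zero, mem_closedBall_zero_iff] at hz
      exact hne z hz
    have hd1 : ‖w - ζ₀‖ ≤ 3 / 2 * s := by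
      have h1 : ‖(r : ℂ) * ζ₀ - ζ₀‖ = s := by
        have : (r : ℂ) * ζ₀ - ζ₀ = ((-s : ℝ) : ℂ) * ζ₀ := by rw [hr']; push_cast; ring
        rw [this, norm_mul, hζ₀, mul_one, Complex.norm_real, norm_neg, Real.norm_of_nonneg hs.le]
      have := norm_add_le (w - r * ζ₀) (r * ζ₀ - ζ₀)
      rw [sub_add_sub_cancel, h1, hw] at this
      linarith
    have hφw := norm_le_of_poissonKernel_mul_norm_le (ε := ε / 20) (K := ε / 20) hφ hwb (by
      intro ζ hζ
      have hzw : ‖ζ - w‖ ≠ 0 := by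
        intro h0
        rw [norm_eq_zero, sub_eq_zero] at h0
        rw [h0] at hζ
        linarith
      have hP : 0 ≤ poissonKernel 0 w ζ := by
        unfold poissonKernel
        refine div_nonneg ?_ (by positivity)
        simp only [sub_zero, hζ]
        nlinarith [norm_nonneg w]
      have hcmp := norm_sub_le_norm_sub_mul hζ.le hζ₀ (t := 1 + s) (by linarith)
      have hpos : 0 < ‖ζ - ((1 + s : ℝ) : ℂ) * ζ₀‖ := norm_pos_iff.2 (hne ζ hζ.le)
      rw [norm_mul, norm_inv, ← div_eq_mul_inv]
      by_cases hn : ‖ζ - ζ₀‖ < δ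
      · have : ‖Φ ζ‖ / ‖ζ - ((1 + s : ℝ) : ℂ) * ζ₀‖ ≤ ε / 20 := by
          rw [div_le_iff₀ hpos]
          exact (hnear ζ hζ hn).trans (by gcongr)
        have := mul_le_mul_of_nonneg_left this hP
        linarith
      · have h1 : ‖Φ ζ‖ / ‖ζ - ((1 + s : ℝ) : ℂ) * ζ₀‖ ≤ L := by
          rw [div_le_iff₀ hpos]
          exact (hlip ζ hζ).trans (by gcongr)
        have h2 : poissonKernel 0 w ζ ≤ 12 * s / δ ^ 2 := by
          unfold poissonKernel
          simp only [sub_zero, hζ]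
          have hfar : δ / 2 ≤ ‖ζ - w‖ := by
            have := norm_add_le (ζ - w) (w - ζ₀)
            rw [sub_add_sub_cancel] at this
            push Not at hn
            linarith
          have hnum : 1 ^ 2 - ‖w‖ ^ 2 ≤ 3 * s := by nlinarith [norm_nonneg w]
          calc (1 ^ 2 - ‖w‖ ^ 2) / ‖ζ - w‖ ^ 2 ≤ 3 * s / (δ / 2) ^ 2 := by gcongr
            _ = 12 * s / δ ^ 2 := by field_simp; ring
        calc poissonKernel 0 w ζ * (‖Φ ζ‖ / ‖ζ - ((1 + s : ℝ) : ℂ) * ζ₀‖)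
            ≤ 12 * s / δ ^ 2 * L := by gcongr
          _ ≤ ε / 20 := by
            rw [div_mul_eq_mul_div, div_le_iff₀ (by positivity)]
            linarith
          _ ≤ _ := by nlinarith)
    have hpos : 0 < ‖w - ((1 + s : ℝ) : ℂ) * ζ₀‖ := norm_pos_iff.2 (hne w hw1.le)
    have hd2 : ‖w - ((1 + s : ℝ) : ℂ) * ζ₀‖ ≤ 5 / 2 * s := by
      have h1 : ‖ζ₀ - ((1 + s : ℝ) : ℂ) * ζ₀‖ = s := by
        have : ζ₀ - ((1 + s : ℝ) : ℂ) * ζ₀ = ((-s : ℝ) : ℂ) * ζ₀ := by push_cast; ring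
        rw [this, norm_mul, hζ₀, mul_one, Complex.norm_real, norm_neg, Real.norm_of_nonneg hs.le]
      have := norm_add_le (w - ζ₀) (ζ₀ - ((1 + s : ℝ) : ℂ) * ζ₀)
      rw [sub_add_sub_cancel, h1] at this
      linarith
    rw [norm_mul, norm_inv, ← div_eq_mul_inv, div_le_iff₀ hpos] at hφw
    nlinarith
  have hdc : DiffContOnCl ℂ Φ (Metric.ball ((r : ℂ) * ζ₀) (s / 2)) :=
    hΦ.mono (Metric.ball_subset_closedBall.trans hball)
  have := Complex.norm_deriv_le_of_forall_mem_sphere_norm_le (by positivity) hdc key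
  rw [dist_zero_right]
  refine this.trans_lt ?_
  rw [div_lt_iff₀ (by positivity)]
  nlinarith

/-- **Fatou's theorem**: a bounded analytic function in the unit disk has radial limits almost
everywhere. -/
theorem ae_exists_radial_limit {g : ℂ → ℂ} (hg : IsBoundedAnalytic g) :
    ∀ᵐ θ : ℝ, ∃ w : ℂ,
      Tendsto (fun r : ℝ => g (r * Complex.exp (θ * Complex.I))) (𝓝[<] 1) (𝓝 w) := by
  obtain ⟨hana, C, hC⟩ := hg
  unfold unitDisk at hana hC
  -- A primitive of `g` is Lipschitz, so its extension to the circle is differentiable at almost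
  -- every angle; at such a point the radial limit of `g` is the derivative along the circle.
  obtain ⟨G₀, hG₀⟩ := hana.differentiableOn.isExactOn_ball
  have hlip₀ : LipschitzOnWith C.toNNReal G₀ (Metric.ball 0 1) := by
    refine Convex.lipschitzOnWith_of_nnnorm_deriv_le (𝕜 := ℂ)
      (fun z hz => (hG₀ z hz).differentiableAt) (fun z hz => ?_) (convex_ball _ _)
    rw [(hG₀ z hz).deriv, ← NNReal.coe_le_coe, coe_nnnorm]
    exact (hC z hz).trans (Real.le_coe_toNNReal C)
  obtain ⟨G, hlip, hEq⟩ := hlip₀.extend_finite_dimension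
  set K := lipschitzExtensionConstant ℂ * C.toNNReal
  have hGd : ∀ z ∈ Metric.ball (0 : ℂ) 1, HasDerivAt G (g z) z := fun z hz =>
    (hG₀ z hz).congr_of_eventuallyEq
      (hEq.symm.eventuallyEq_of_mem (Metric.isOpen_ball.mem_nhds hz))
  have hGc : DiffContOnCl ℂ G (Metric.ball 0 1) :=
    ⟨fun z hz => (hGd z hz).differentiableAt.differentiableWithinAt, hlip.continuous.continuousOn⟩
  have hElip : LipschitzWith 1 fun θ : ℝ => Complex.exp (θ * Complex.I) := by
    refine lipschitzWith_of_nnnorm_deriv_le (𝕜 := ℝ)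
      (fun θ => (hasDerivAt_exp_ofReal_mul_I θ).differentiableAt) fun θ => ?_
    rw [(hasDerivAt_exp_ofReal_mul_I θ).deriv, ← NNReal.coe_le_coe, coe_nnnorm]
    simp [Complex.norm_exp_ofReal_mul_I]
  filter_upwards [(hlip.comp hElip).ae_differentiableAt_real] with θ hθ
  obtain ⟨A, hA⟩ := exists_deriv_along_circle hθ
  set ζ₀ := Complex.exp (θ * Complex.I)
  have hζ₀ : ‖ζ₀‖ = 1 := Complex.norm_exp_ofReal_mul_I θ
  refine ⟨A, ?_⟩
  have hdiff : DiffContOnCl ℂ (fun z => G z - G ζ₀ - A * (z - ζ₀)) (Metric.ball 0 1) :=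
    (hGc.sub_const _).sub (Differentiable.diffContOnCl (by fun_prop))
  have := tendsto_deriv_radial_of_isLittleO_boundary (L := K + ‖A‖) hdiff hζ₀ (by positivity)
    (fun ζ _ => by
      calc _ ≤ ‖G ζ - G ζ₀‖ + ‖A * (ζ - ζ₀)‖ := norm_sub_le _ _
        _ ≤ K * ‖ζ - ζ₀‖ + ‖A‖ * ‖ζ - ζ₀‖ := by
          rw [norm_mul]
          gcongr
          simpa [dist_eq_norm] using hlip.dist_le_mul ζ ζ₀
        _ = _ := by ring) hA
  rw [← tendsto_sub_nhds_zero_iff]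
  refine this.congr' ?_
  filter_upwards [self_mem_nhdsWithin, nhdsWithin_le_nhds (lt_mem_nhds one_pos)] with r hr hr0
  have hmem : (r : ℂ) * ζ₀ ∈ Metric.ball (0 : ℂ) 1 := by
    rw [mem_ball_zero_iff, norm_mul, hζ₀, mul_one, Complex.norm_real, Real.norm_of_nonneg hr0.le]
    exact hr
  have h1 : HasDerivAt (fun z => G z - G ζ₀ - A * (z - ζ₀)) (g (r * ζ₀) - A * 1) (r * ζ₀) :=
    ((hGd _ hmem).sub_const _).sub (((hasDerivAt_id _).sub_const ζ₀).const_mul A)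
  rw [h1.deriv, mul_one]

/-! ### Nonvanishing of radial limits -/

/-- In Jensen's formula the zeros contribute nonnegative terms. -/
theorem log_norm_le_circleAverage_log_norm {h : ℂ → ℂ} {r : ℝ} (hr : 0 < r)
    (hh : AnalyticOnNhd ℂ h (Metric.closedBall 0 r)) (h0 : h 0 ≠ 0) :
    Real.log ‖h 0‖ ≤ Real.circleAverage (fun z => Real.log ‖h z‖) 0 r := by
  have hh' : AnalyticOnNhd ℂ h (Metric.closedBall 0 |r|) := by rwa [abs_of_pos hr]
  rw [hh'.circleAverage_log_norm hr.ne' h0, le_add_iff_nonneg_left]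
  refine finsum_nonneg fun u => ?_
  have hdiv : 0 ≤ MeromorphicOn.divisor h (Metric.closedBall 0 |r|) u :=
    (MeromorphicOn.AnalyticOnNhd.divisor_nonneg hh') u
  by_cases hu : u ∈ Metric.closedBall (0 : ℂ) |r|
  · refine mul_nonneg (by exact_mod_cast hdiv) ?_
    rw [zero_sub, norm_neg]
    rcases eq_or_ne u 0 with rfl | hu0
    · simp
    · refine Real.log_nonneg ?_
      rw [mem_closedBall_zero_iff, abs_of_pos hr] at hu
      rw [← div_eq_mul_inv, one_le_div (norm_pos_iff.2 hu0)]
      exact hu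
  · rw [Function.locallyFinsuppWithin.apply_eq_zero_of_notMem _ hu]
    simp

/-- The zeros are countable, hence so are their moduli. -/
theorem exists_radius_forall_ne_zero {h : ℂ → ℂ} (hh : AnalyticOnNhd ℂ h unitDisk) (h0 : h 0 ≠ 0)
    {a : ℝ} (ha : a < 1) :
    ∃ r, a < r ∧ r < 1 ∧ ∀ z : ℂ, ‖z‖ = r → h z ≠ 0 := by
  have hcod := hh.preimage_zero_mem_codiscreteWithin (x := 0) h0 (by simp [unitDisk])
    ⟨⟨0, by simp [unitDisk]⟩, (convex_ball _ _).isPreconnected⟩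
  have hcount : ((h ⁻¹' {0}) ∩ unitDisk).Countable := by
    apply (HereditarilyLindelofSpace.isLindelof _).countable_of_isDiscrete
      (isDiscrete_of_codiscreteWithin _)
    simpa using hcod
  have hdense := (hcount.image norm).dense_compl ℝ
  obtain ⟨r, hr, hra⟩ := hdense.exists_mem_open isOpen_Ioo (Set.nonempty_Ioo.2 ha)
  refine ⟨r, hra.1, hra.2, fun z hz h1 => hr ⟨z, ⟨h1, ?_⟩, hz⟩⟩
  simpa [unitDisk, hz] using hra.2

theorem ae_Ioc_not_tendsto_radial_zero {h : ℂ → ℂ} (hh : IsBoundedAnalytic h) (h0 : h 0 ≠ 0) :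
    ∀ᵐ θ : ℝ, θ ∈ Set.Ioc 0 (2 * Real.pi) →
      ¬ Tendsto (fun r : ℝ => h (r * Complex.exp (θ * Complex.I))) (𝓝[<] 1) (𝓝 0) := by
  obtain ⟨hana, C₀, hC₀⟩ := hh
  set C := max C₀ 1
  have hC : ∀ z ∈ unitDisk, ‖h z‖ ≤ C := fun z hz => (hC₀ z hz).trans (le_max_left _ _)
  -- Zero-free circles keep log|h| continuous and avoid the default value log 0 = 0, which would
  -- hide the blow-up at a vanishing radial limit.
  have hrad : ∀ n : ℕ, ∃ r, 1 - 1 / ((n : ℝ) + 2) < r ∧ r < 1 ∧ ∀ z : ℂ, ‖z‖ = r → h z ≠ 0 := by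
    intro n
    refine exists_radius_forall_ne_zero hana h0 ?_
    have : 0 < 1 / ((n : ℝ) + 2) := by positivity
    linarith
  choose r hr1 hr2 hr3 using hrad
  have hr0 : ∀ n, 0 < r n := fun n => by
    refine lt_trans ?_ (hr1 n)
    rw [sub_pos, div_lt_one (by positivity)]
    linarith [n.cast_nonneg (α := ℝ)]
  have hrt : Tendsto r atTop (𝓝[<] 1) := by
    refine tendsto_nhdsWithin_iff.2 ⟨?_, Eventually.of_forall hr2⟩
    refine tendsto_of_tendsto_of_tendsto_of_le_of_le (g := fun n : ℕ => 1 - 1 / ((n : ℝ) + 2))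
      ?_ tendsto_const_nhds (fun n => (hr1 n).le) (fun n => (hr2 n).le)
    have : Tendsto (fun n : ℕ => 1 / ((n : ℝ) + 2)) atTop (𝓝 0) := by
      simp_rw [one_div]
      exact (tendsto_natCast_atTop_atTop.atTop_add tendsto_const_nhds).inv_tendsto_atTop
    simpa using this.const_sub 1
  have hmem : ∀ n, ∀ z : ℂ, ‖z‖ ≤ r n → z ∈ unitDisk := fun n z hz => by
    rw [unitDisk, mem_ball_zero_iff]
    exact hz.trans_lt (hr2 n)
  have hnorm : ∀ n (θ : ℝ), ‖circleMap 0 (r n) θ‖ = r n := fun n θ => by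
    simp [abs_of_pos (hr0 n)]
  set u : ℕ → ℝ → ℝ := fun n θ => Real.log C - Real.log ‖h (circleMap 0 (r n) θ)‖
  have hu0 : ∀ n θ, 0 ≤ u n θ := fun n θ => by
    refine sub_nonneg.2 (Real.log_le_log ?_ (hC _ (hmem n _ (hnorm n θ).le)))
    exact norm_pos_iff.2 (hr3 n _ (hnorm n θ))
  have hhc : ∀ n, Continuous fun θ => h (circleMap 0 (r n) θ) := fun n =>
    continuous_iff_continuousAt.2 fun θ =>
      ContinuousAt.comp (f := circleMap 0 (r n)) (hana _ (hmem n _ (hnorm n θ).le)).continuousAt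
        (continuous_circleMap _ _).continuousAt
  have hlc : ∀ n, Continuous fun θ => Real.log ‖h (circleMap 0 (r n) θ)‖ := fun n =>
    (hhc n).norm.log fun θ => norm_ne_zero_iff.2 (hr3 n _ (hnorm n θ))
  have huc : ∀ n, Continuous (u n) := fun n => continuous_const.sub (hlc n)
  set μ : Measure ℝ := volume.restrict (Set.Ioc 0 (2 * Real.pi))
  have hint : ∀ n, ∫⁻ θ, ENNReal.ofReal (u n θ) ∂μ ≤
      ENNReal.ofReal (2 * Real.pi * (Real.log C - Real.log ‖h 0‖)) := by
    intro n
    have hii : IntervalIntegrable (u n) volume 0 (2 * Real.pi) := (huc n).intervalIntegrable _ _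
    rw [← ofReal_integral_eq_lintegral_ofReal
      ((intervalIntegrable_iff_integrableOn_Ioc_of_le (by positivity)).1 hii)
      (Eventually.of_forall (hu0 n)), ← intervalIntegral.integral_of_le (by positivity)]
    refine ENNReal.ofReal_le_ofReal ?_
    have hJ := log_norm_le_circleAverage_log_norm (hr0 n) (fun z hz => hana z (hmem n z (by
      simpa using hz))) h0
    rw [Real.circleAverage_def, smul_eq_mul, inv_mul_eq_div, le_div_iff₀ (by positivity)] at hJ
    rw [intervalIntegral.integral_sub (by simp) ((hlc n).intervalIntegrable _ _)]
    simp only [intervalIntegral.integral_const, sub_zero, smul_eq_mul]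
    linarith
  -- Fatou's lemma with the uniform Jensen bound: the liminf is finite a.e., while a zero radial
  -- limit would force it to be infinite.
  have hfin : ∫⁻ θ, liminf (fun n => ENNReal.ofReal (u n θ)) atTop ∂μ ≠ ⊤ := by
    refine ((lintegral_liminf_le fun n => (huc n).measurable.ennreal_ofReal).trans
      (liminf_le_of_frequently_le' (Frequently.of_forall hint))).trans_lt
        ENNReal.ofReal_lt_top |>.ne
  have hae := ae_lt_top (Measurable.liminf fun n => (huc n).measurable.ennreal_ofReal) hfin
  rw [ae_restrict_iff' measurableSet_Ioc] at hae
  filter_upwards [hae] with θ hθ hmemθ htend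
  refine (hθ hmemθ).ne ?_
  have h1 : Tendsto (fun n => h (circleMap 0 (r n) θ)) atTop (𝓝 0) := by
    have := htend.comp hrt
    refine this.congr fun n => ?_
    simp [circleMap]
  have h2 : Tendsto (fun n => ‖h (circleMap 0 (r n) θ)‖) atTop (𝓝[≠] 0) := by
    refine tendsto_nhdsWithin_iff.2 ⟨by simpa using h1.norm, Eventually.of_forall fun n => ?_⟩
    exact norm_ne_zero_iff.2 (hr3 n _ (hnorm n θ))
  have h3 : Tendsto (fun n => u n θ) atTop atTop := by
    have := tendsto_neg_atBot_atTop.comp (Real.tendsto_log_nhdsNE_zero.comp h2)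
    exact tendsto_atTop_add_const_left _ (Real.log C) this
  exact (ENNReal.tendsto_ofReal_atTop.comp h3).liminf_eq

/-- A bounded analytic function in the unit disk, not vanishing at the origin, has a vanishing
radial limit almost nowhere. -/
theorem ae_not_tendsto_radial_zero {h : ℂ → ℂ} (hh : IsBoundedAnalytic h) (h0 : h 0 ≠ 0) :
    ∀ᵐ θ : ℝ, ¬ Tendsto (fun r : ℝ => h (r * Complex.exp (θ * Complex.I))) (𝓝[<] 1) (𝓝 0) := by
  have hall : ∀ k : ℤ, ∀ᵐ θ : ℝ, θ + k • (2 * Real.pi) ∈ Set.Ioc 0 (2 * Real.pi) →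
      ¬ Tendsto (fun r : ℝ => h (r * Complex.exp (((θ + k • (2 * Real.pi) : ℝ) : ℂ) * Complex.I)))
        (𝓝[<] 1) (𝓝 0) := fun k =>
    (measurePreserving_add_right volume (k • (2 * Real.pi))).quasiMeasurePreserving.ae
      (ae_Ioc_not_tendsto_radial_zero hh h0)
  filter_upwards [ae_all_iff.2 hall] with θ hθ
  obtain ⟨k, hk, -⟩ := existsUnique_add_zsmul_mem_Ioc Real.two_pi_pos θ 0
  have := hθ k (by simpa using hk)
  convert this using 5
  have : ((θ + k • (2 * Real.pi) : ℝ) : ℂ) * Complex.I =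
      θ * Complex.I + k * (2 * Real.pi * Complex.I) := by
    push_cast [zsmul_eq_mul]
    ring
  rw [this, Complex.exp_add, Complex.exp_int_mul_two_pi_mul_I, mul_one]

/-! ### Schur functions with prescribed parameters -/

theorem one_add_conj_mul_ne_zero {a u : ℂ} (ha : ‖a‖ < 1) (hu : ‖u‖ ≤ 1) : 1 + conj a * u ≠ 0 := by
  intro h
  have h1 : ‖conj a * u‖ = 1 := by
    rw [eq_neg_of_add_eq_zero_right h, norm_neg, norm_one]
  rw [norm_mul, RCLike.norm_conj] at h1
  nlinarith [norm_nonneg a, norm_nonneg u]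

/-- The Möbius matrix preserves the indefinite form |q|² - |p|² up to the factor 1 - |a|². This
gives both the Schur bound for |a| < 1 and the sign rule on the circle for any a. -/
theorem normSq_moebius_sub (a p q : ℂ) :
    ‖q + conj a * p‖ ^ 2 - ‖a * q + p‖ ^ 2 = (1 - ‖a‖ ^ 2) * (‖q‖ ^ 2 - ‖p‖ ^ 2) := by
  simp only [← Complex.normSq_eq_norm_sq, Complex.normSq_apply, Complex.add_re, Complex.add_im,
    Complex.mul_re, Complex.mul_im, Complex.conj_re, Complex.conj_im]
  ring

theorem norm_moebius_le_one {a u : ℂ} (ha : ‖a‖ < 1) (hu : ‖u‖ ≤ 1) :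
    ‖(a + u) / (1 + conj a * u)‖ ≤ 1 := by
  rw [norm_div, div_le_one (norm_pos_iff.2 (one_add_conj_mul_ne_zero ha hu))]
  refine le_of_sq_le_sq ?_ (norm_nonneg _)
  have h := normSq_moebius_sub a u 1
  rw [mul_one, norm_one] at h
  have ha' : 0 ≤ 1 - ‖a‖ ^ 2 := by nlinarith [norm_nonneg a]
  have hu' : 0 ≤ 1 - ‖u‖ ^ 2 := by nlinarith [norm_nonneg u]
  nlinarith [mul_nonneg ha' hu']

/-- The Schur function with parameters `α m, α (m + 1), …, α (m + k - 1), 0, 0, …`. -/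
noncomputable def schurApprox (α : ℕ → ℂ) : ℕ → ℕ → ℂ → ℂ
  | 0, _, _ => 0
  | k + 1, m, z =>
    (α m + z * schurApprox α k (m + 1) z) / (1 + conj (α m) * (z * schurApprox α k (m + 1) z))

theorem schurApprox_succ (α : ℕ → ℂ) (k m : ℕ) (z : ℂ) :
    schurApprox α (k + 1) m z =
      (α m + z * schurApprox α k (m + 1) z) / (1 + conj (α m) * (z * schurApprox α k (m + 1) z)) :=
  rfl

theorem norm_schurApprox_le_one {α : ℕ → ℂ} (hα : ∀ n, ‖α n‖ < 1) (k m : ℕ) {z : ℂ}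
    (hz : z ∈ unitDisk) :
    ‖schurApprox α k m z‖ ≤ 1 := by
  induction k generalizing m with
  | zero => simp [schurApprox]
  | succ k ih =>
    have hz' : ‖z‖ < 1 := by simpa [unitDisk] using hz
    refine norm_moebius_le_one (hα m) ?_
    rw [norm_mul]
    exact mul_le_one₀ hz'.le (norm_nonneg _) (ih _)

theorem one_add_conj_mul_schurApprox_ne_zero {α : ℕ → ℂ} (hα : ∀ n, ‖α n‖ < 1) (k m : ℕ) {z : ℂ}
    (hz : z ∈ unitDisk) :
    1 + conj (α m) * (z * schurApprox α k (m + 1) z) ≠ 0 := by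
  have hz' : ‖z‖ < 1 := by simpa [unitDisk] using hz
  refine one_add_conj_mul_ne_zero (hα m) ?_
  rw [norm_mul]
  exact mul_le_one₀ hz'.le (norm_nonneg _) (norm_schurApprox_le_one hα k _ hz)

theorem differentiableOn_schurApprox {α : ℕ → ℂ} (hα : ∀ n, ‖α n‖ < 1) (k m : ℕ) :
    DifferentiableOn ℂ (schurApprox α k m) unitDisk := by
  induction k generalizing m with
  | zero => exact differentiableOn_const 0
  | succ k ih =>
    have := ih (m + 1)
    exact DifferentiableOn.div (by fun_prop) (by fun_prop)
      fun z hz => one_add_conj_mul_schurApprox_ne_zero hα k m hz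

/-- Each Möbius step turns a difference of arguments into the same difference times z times a factor
bounded near 0, so one order of vanishing is gained per level. -/
theorem schurApprox_succ_sub_isBigO {α : ℕ → ℂ} (hα : ∀ n, ‖α n‖ < 1) (k m : ℕ) :
    (fun z => schurApprox α (k + 1) m z - schurApprox α k m z) =O[𝓝 0] fun z : ℂ => ‖z‖ ^ k := by
  have hdisk : unitDisk ∈ 𝓝 (0 : ℂ) := Metric.ball_mem_nhds _ one_pos
  induction k generalizing m with
  | zero =>
    refine Asymptotics.IsBigO.of_bound 2 ?_
    filter_upwards [hdisk] with z hz
    refine (norm_sub_le _ _).trans ?_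
    simp only [pow_zero, norm_one, mul_one]
    linarith [norm_schurApprox_le_one hα 1 m hz, norm_schurApprox_le_one hα 0 m hz]
  | succ k ih =>
    have hcont : ∀ j n, ContinuousAt (schurApprox α j n) 0 := fun j n =>
      (differentiableOn_schurApprox hα j n).continuousOn.continuousAt hdisk
    have hden : ∀ j, ContinuousAt
        (fun z => 1 + conj (α m) * (z * schurApprox α j (m + 1) z)) 0 := fun j => by
      have := hcont j (m + 1)
      fun_prop
    set c : ℂ → ℂ := fun z => (1 - conj (α m) * α m) /
      ((1 + conj (α m) * (z * schurApprox α (k + 1) (m + 1) z)) *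
        (1 + conj (α m) * (z * schurApprox α k (m + 1) z))) with hc
    have hcO : c =O[𝓝 0] fun _ => (1 : ℝ) := by
      have h1 : ContinuousAt c 0 := by
        refine ContinuousAt.div continuousAt_const ((hden _).mul (hden _)) ?_
        simp
      exact h1.isBigO_one ℝ
    have hzO : (fun z : ℂ => z) =O[𝓝 0] fun z : ℂ => ‖z‖ := Asymptotics.isBigO_refl _ _ |>.norm_right
    refine ((hcO.mul (hzO.mul (ih (m + 1)))).congr' ?_ ?_)
    · filter_upwards [hdisk] with z hz
      have h1 := one_add_conj_mul_schurApprox_ne_zero hα (k + 1) m hz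
      have h2 := one_add_conj_mul_schurApprox_ne_zero hα k m hz
      rw [schurApprox_succ α (k + 1) m z, schurApprox_succ α k m z, hc]
      dsimp only
      rw [div_sub_div _ _ h1 h2, div_mul_eq_mul_div]
      congr 1
      ring
    · exact Eventually.of_forall fun z => by ring

/-- Higher-order Schwarz lemma: the difference is bounded by 2 and vanishes at 0 to order k + 1.
Level 0 is left out because its value at 0 need not be `α m`. -/
theorem norm_schurApprox_succ_sub_le {α : ℕ → ℂ} (hα : ∀ n, ‖α n‖ < 1) (k m : ℕ) {z : ℂ}
    (hz : z ∈ unitDisk) :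
    ‖schurApprox α (k + 2) m z - schurApprox α (k + 1) m z‖ ≤ 2 * ‖z‖ ^ (k + 1) := by
  set f : ℂ → ℂ := fun z => schurApprox α (k + 2) m z - schurApprox α (k + 1) m z with hf
  have h0 : f 0 = 0 := by simp [hf, schurApprox]
  have hd : DifferentiableOn ℂ f (Metric.ball 0 1) :=
    (differentiableOn_schurApprox hα _ _).sub (differentiableOn_schurApprox hα _ _)
  have hmaps : Set.MapsTo f (Metric.ball 0 1) (Metric.closedBall (f 0) 2) := by
    intro w hw
    rw [h0, mem_closedBall_zero_iff]
    refine (norm_sub_le _ _).trans ?_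
    linarith [norm_schurApprox_le_one hα (k + 2) m hw, norm_schurApprox_le_one hα (k + 1) m hw]
  have hlo : (fun x => f x - f 0) =o[𝓝 0] fun w : ℂ => ‖w - 0‖ ^ k := by
    simp only [h0, sub_zero]
    refine (schurApprox_succ_sub_isBigO hα (k + 1) m).trans_isLittleO ?_
    have : (fun z : ℂ => ‖z‖ ^ (k + 1)) = fun z : ℂ => ‖z‖ * ‖z‖ ^ k := by ext z; ring
    rw [this]
    have h1 : (fun z : ℂ => ‖z‖) =o[𝓝 0] fun _ => (1 : ℝ) := by
      rw [Asymptotics.isLittleO_one_iff]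
      simpa using (continuous_norm (E := ℂ)).tendsto 0
    simpa using h1.mul_isBigO (Asymptotics.isBigO_refl (fun z : ℂ => ‖z‖ ^ k) (𝓝 0))
  have := Complex.dist_le_mul_div_pow_of_mapsTo_ball_of_isLittleO hd hmaps hlo hz
  simpa [h0] using this

/-- Every sequence of points of the open unit disk is the sequence of Schur parameters of an
analytic function bounded by one. -/
theorem exists_schur_functions {α : ℕ → ℂ} (hα : ∀ n, ‖α n‖ < 1) :
    ∃ s : ℕ → ℂ → ℂ, ∀ n, AnalyticOnNhd ℂ (s n) unitDisk ∧ (∀ z ∈ unitDisk, ‖s n z‖ ≤ 1) ∧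
      ∀ z ∈ unitDisk, s n z * (1 + conj (α n) * (z * s (n + 1) z)) = α n + z * s (n + 1) z := by
  have hdist : ∀ m, ∀ z ∈ unitDisk, ∀ k, dist (schurApprox α (k + 1) m z)
      (schurApprox α (k + 1 + 1) m z) ≤ 2 * ‖z‖ * ‖z‖ ^ k := fun m z hz k => by
    rw [dist_comm, dist_eq_norm]
    refine (norm_schurApprox_succ_sub_le hα k m hz).trans_eq ?_
    ring
  have hlim : ∀ m z, ∃ w, z ∈ unitDisk →
      Tendsto (fun k => schurApprox α (k + 1) m z) atTop (𝓝 w) := by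
    intro m z
    by_cases hz : z ∈ unitDisk
    · have hz' : ‖z‖ < 1 := by simpa [unitDisk] using hz
      obtain ⟨w, hw⟩ := cauchySeq_tendsto_of_complete
        (cauchySeq_of_le_geometric _ _ hz' (hdist m z hz))
      exact ⟨w, fun _ => hw⟩
    · exact ⟨0, fun h => absurd h hz⟩
  choose s hs using hlim
  refine ⟨s, fun n => ⟨?_, ?_, ?_⟩⟩
  · have hloc : TendstoLocallyUniformlyOn (fun k => schurApprox α (k + 1) n) (s n) atTop
        unitDisk := by
      rw [tendstoLocallyUniformlyOn_iff_forall_isCompact (s := unitDisk) Metric.isOpen_ball]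
      intro K hK hKc
      obtain ⟨ρ, hρ0, hρ1, hρ⟩ : ∃ ρ, 0 ≤ ρ ∧ ρ < 1 ∧ ∀ z ∈ K, ‖z‖ ≤ ρ := by
        rcases K.eq_empty_or_nonempty with rfl | hne
        · exact ⟨0, le_rfl, one_pos, by simp⟩
        · obtain ⟨x, hx, hmax⟩ := hKc.exists_isMaxOn hne continuous_norm.continuousOn
          exact ⟨‖x‖, norm_nonneg _, by simpa [unitDisk] using hK hx, fun z hz => hmax hz⟩
      rw [Metric.tendstoUniformlyOn_iff]
      intro ε hε
      have htend : Tendsto (fun k : ℕ => 2 * ρ * ρ ^ k / (1 - ρ)) atTop (𝓝 0) := by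
        have := ((tendsto_pow_atTop_nhds_zero_of_lt_one hρ0 hρ1).const_mul (2 * ρ)).div_const (1 - ρ)
        simpa using this
      filter_upwards [htend.eventually (gt_mem_nhds hε)] with k hk z hz
      rw [dist_comm]
      refine (dist_le_of_le_geometric_of_tendsto ρ (2 * ρ) hρ1 (fun j => ?_)
        (hs n z (hK hz)) k).trans_lt hk
      refine (hdist n z (hK hz) j).trans ?_
      have := hρ z hz
      gcongr
    exact (hloc.differentiableOn
      (Eventually.of_forall fun k => differentiableOn_schurApprox hα (k + 1) n)
      Metric.isOpen_ball).analyticOnNhd Metric.isOpen_ball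
  · intro z hz
    exact le_of_tendsto (hs n z hz).norm
      (Eventually.of_forall fun k => norm_schurApprox_le_one hα (k + 1) n hz)
  · intro z hz
    have h1 := (hs n z hz).comp (tendsto_add_atTop_nat 1)
    have h2 := (hs (n + 1) z hz).const_mul z
    refine tendsto_nhds_unique (h1.mul ((h2.const_mul (conj (α n))).const_add 1))
      ((h2.const_add (α n)).congr fun k => ?_)
    have := one_add_conj_mul_schurApprox_ne_zero hα (k + 1) n hz
    simp only [Function.comp_apply]
    rw [schurApprox_succ α (k + 1) n z, div_mul_cancel₀ _ this]

/-! ### Prescribed parameters off the unit circle -/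

theorem IsBoundedAnalytic.const (c : ℂ) : IsBoundedAnalytic fun _ => c :=
  ⟨analyticOnNhd_const, ‖c‖, fun _ _ => le_rfl⟩

theorem isBoundedAnalytic_id : IsBoundedAnalytic fun z => z :=
  ⟨analyticOnNhd_id, 1, fun z hz => by
    rw [unitDisk, mem_ball_zero_iff] at hz
    exact hz.le⟩

theorem IsBoundedAnalytic.add {f g : ℂ → ℂ} (hf : IsBoundedAnalytic f) (hg : IsBoundedAnalytic g) :
    IsBoundedAnalytic fun z => f z + g z := by
  obtain ⟨hf, C, hC⟩ := hf
  obtain ⟨hg, D, hD⟩ := hg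
  exact ⟨hf.add hg, C + D, fun z hz => (norm_add_le _ _).trans (add_le_add (hC z hz) (hD z hz))⟩

theorem IsBoundedAnalytic.sub {f g : ℂ → ℂ} (hf : IsBoundedAnalytic f) (hg : IsBoundedAnalytic g) :
    IsBoundedAnalytic fun z => f z - g z := by
  obtain ⟨hf, C, hC⟩ := hf
  obtain ⟨hg, D, hD⟩ := hg
  exact ⟨hf.sub hg, C + D, fun z hz => (norm_sub_le _ _).trans (add_le_add (hC z hz) (hD z hz))⟩

theorem IsBoundedAnalytic.mul {f g : ℂ → ℂ} (hf : IsBoundedAnalytic f) (hg : IsBoundedAnalytic g) :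
    IsBoundedAnalytic fun z => f z * g z := by
  obtain ⟨hf, C, hC⟩ := hf
  obtain ⟨hg, D, hD⟩ := hg
  refine ⟨hf.mul hg, C * D, fun z hz => ?_⟩
  rw [norm_mul]
  exact mul_le_mul (hC z hz) (hD z hz) (norm_nonneg _) ((norm_nonneg _).trans (hC z hz))

theorem tendsto_radius_mul_exp (θ : ℝ) :
    Tendsto (fun r : ℝ => (r : ℂ) * Complex.exp (θ * Complex.I)) (𝓝[<] 1)
      (𝓝 (Complex.exp (θ * Complex.I))) := by
  have : Tendsto (fun r : ℝ => (r : ℂ) * Complex.exp (θ * Complex.I)) (𝓝 1)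
      (𝓝 (((1 : ℝ) : ℂ) * Complex.exp (θ * Complex.I))) := Continuous.tendsto (by fun_prop) 1
  rw [Complex.ofReal_one, one_mul] at this
  exact this.mono_left nhdsWithin_le_nhds

theorem radius_mul_exp_mem_unitDisk {r : ℝ} (h0 : 0 < r) (h1 : r < 1) (θ : ℝ) :
    (r : ℂ) * Complex.exp (θ * Complex.I) ∈ unitDisk := by
  rwa [unitDisk, mem_ball_zero_iff, norm_mul, Complex.norm_exp_ofReal_mul_I, mul_one,
    Complex.norm_real, Real.norm_of_nonneg h0.le]

theorem eventually_radius_mul_exp_mem_unitDisk (θ : ℝ) :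
    ∀ᶠ r : ℝ in 𝓝[<] 1, (r : ℂ) * Complex.exp (θ * Complex.I) ∈ unitDisk := by
  filter_upwards [self_mem_nhdsWithin, nhdsWithin_le_nhds (lt_mem_nhds one_pos)] with r hr hr0
  exact radius_mul_exp_mem_unitDisk hr0 hr θ

/-- The functions `P n / Q n` have Schur parameters `α n, α (n + 1), …`. The squared norms of the
boundary values of `P 0` and `Q 0` compare in the same way at almost every point of the circle. -/
theorem exists_schur_fractions (N : ℕ) (α : ℕ → ℂ) (h₁ : ∀ n < N, ‖α n‖ ≠ 1)
    (h₂ : ∀ n ≥ N, ‖α n‖ < 1) :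
    ∃ P Q : ℕ → ℂ → ℂ, (∀ n, IsBoundedAnalytic (P n) ∧ IsBoundedAnalytic (Q n) ∧
      P n 0 = α n ∧ Q n 0 = 1 ∧ ∀ z ∈ unitDisk,
        (P n z - α n * Q n z) * Q (n + 1) z = z * P (n + 1) z * (Q n z - conj (α n) * P n z)) ∧
      ∃ ε : ℝ, (ε = 1 ∨ ε = -1) ∧ ∀ᵐ θ : ℝ, ∃ p q : ℂ,
        Tendsto (fun r : ℝ => P 0 (r * Complex.exp (θ * Complex.I))) (𝓝[<] 1) (𝓝 p) ∧
        Tendsto (fun r : ℝ => Q 0 (r * Complex.exp (θ * Complex.I))) (𝓝[<] 1) (𝓝 q) ∧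
        0 ≤ ε * (‖q‖ ^ 2 - ‖p‖ ^ 2) := by
  induction N generalizing α with
  | zero =>
    obtain ⟨s, hs⟩ := exists_schur_functions (α := α) fun n => h₂ n n.zero_le
    have hba : ∀ n, IsBoundedAnalytic (s n) := fun n => ⟨(hs n).1, 1, (hs n).2.1⟩
    refine ⟨s, fun _ _ => 1, fun n => ⟨hba n, .const 1, ?_, rfl, fun z hz => ?_⟩, 1, .inl rfl, ?_⟩
    · simpa using (hs n).2.2 0 (by simp [unitDisk])
    · linear_combination (hs n).2.2 z hz
    · filter_upwards [ae_exists_radial_limit (hba 0)] with θ ⟨w, hw⟩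
      refine ⟨w, 1, hw, tendsto_const_nhds, ?_⟩
      have : ‖w‖ ≤ 1 := le_of_tendsto hw.norm <|
        (eventually_radius_mul_exp_mem_unitDisk θ).mono fun r hr => (hs 0).2.1 _ hr
      rw [norm_one]
      nlinarith [norm_nonneg w]
  | succ N ih =>
    obtain ⟨P, Q, hPQ, ε, hε, hb⟩ := ih (fun n => α (n + 1))
      (fun n hn => h₁ (n + 1) (by lia)) (fun n hn => h₂ (n + 1) (by lia))
    obtain ⟨hP, hQ, -, hQ0, -⟩ := hPQ 0
    -- The new pair satisfies P - aQ = (1 - |a|²)zP₁ and Q - āP = (1 - |a|²)Q₁, where (P₁, Q₁) is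
    -- the old one; this is the recursion with denominators cleared. The sign flips unless |a| < 1.
    refine ⟨fun n => n.casesOn (fun z => α 0 * Q 0 z + z * P 0 z) P,
      fun n => n.casesOn (fun z => Q 0 z + conj (α 0) * (z * P 0 z)) Q, fun n => ?_,
      if ‖α 0‖ < 1 then ε else -ε, ?_, ?_⟩
    · cases n with
      | zero =>
        refine ⟨((IsBoundedAnalytic.const _).mul hQ).add (isBoundedAnalytic_id.mul hP),
          hQ.add ((IsBoundedAnalytic.const _).mul (isBoundedAnalytic_id.mul hP)), ?_, ?_, ?_⟩
        · simp [hQ0]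
        · simp [hQ0]
        · intro z _
          change (α 0 * Q 0 z + z * P 0 z - α 0 * (Q 0 z + conj (α 0) * (z * P 0 z))) * Q 0 z =
            z * P 0 z * (Q 0 z + conj (α 0) * (z * P 0 z) -
              conj (α 0) * (α 0 * Q 0 z + z * P 0 z))
          ring
      | succ n => exact hPQ n
    · split_ifs
      · exact hε
      · rcases hε with rfl | rfl <;> simp
    · filter_upwards [hb] with θ ⟨p, q, hp, hq, hpq⟩
      set ζ := Complex.exp (θ * Complex.I)
      have hζ : ‖ζ‖ = 1 := Complex.norm_exp_ofReal_mul_I θ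
      have hz : Tendsto (fun r : ℝ => (r : ℂ) * ζ) (𝓝[<] 1) (𝓝 ζ) := tendsto_radius_mul_exp θ
      refine ⟨α 0 * q + ζ * p, q + conj (α 0) * (ζ * p), (hq.const_mul _).add (hz.mul hp),
        hq.add ((hz.mul hp).const_mul _), ?_⟩
      rw [normSq_moebius_sub, norm_mul, hζ, one_mul]
      split_ifs with h
      · have : 0 ≤ 1 - ‖α 0‖ ^ 2 := by nlinarith [norm_nonneg (α 0)]
        nlinarith
      · have : 0 ≤ ‖α 0‖ ^ 2 - 1 := by nlinarith [norm_nonneg (α 0)]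
        nlinarith

/-! ### The inverse Schur recursion near the origin -/

theorem zero_mem_unitDisk : (0 : ℂ) ∈ unitDisk := by simp [unitDisk]

theorem unitDisk_mem_nhds : unitDisk ∈ 𝓝 (0 : ℂ) := Metric.ball_mem_nhds _ one_pos

theorem schurStep_eventuallyEq {f : ℂ → ℂ} (hf : MeromorphicOn f unitDisk) :
    schurStep f =ᶠ[𝓝[≠] 0] fun z => 1 / z * ((f z - f 0) / (1 - conj (f 0) * f z)) := by
  refine MeromorphicOn.toMeromorphicNFOn_eq_self_on_nhdsNE (fun x hx => ?_) zero_mem_unitDisk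
  have := hf x hx
  fun_prop

theorem schurSeed_eventuallyEq {F : ℂ → ℂ} (hF : MeromorphicOn F unitDisk)
    (h0 : ¬ meromorphicOrderAt F 0 < 0) :
    schurSeed F =ᶠ[𝓝[≠] 0] fun z => 1 / z * ((F z - F 0) / (F z + F 0)) := by
  rw [schurSeed, if_neg h0]
  refine MeromorphicOn.toMeromorphicNFOn_eq_self_on_nhdsNE (fun x hx => ?_) zero_mem_unitDisk
  have := hF x hx
  fun_prop

theorem meromorphicNFOn_schurIterate {F : ℂ → ℂ} (h0 : ¬ meromorphicOrderAt F 0 < 0) (n : ℕ) :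
    MeromorphicNFOn (schurIterate F n) unitDisk := by
  cases n with
  | zero =>
    rw [schurIterate, schurSeed, if_neg h0]
    exact meromorphicNFOn_toMeromorphicNFOn _ _
  | succ n => exact meromorphicNFOn_toMeromorphicNFOn _ _

theorem one_sub_conj_mul_self_ne_zero {a : ℂ} (ha : ‖a‖ ≠ 1) : 1 - conj a * a ≠ 0 := by
  rw [mul_comm, Complex.mul_conj, Complex.normSq_eq_norm_sq]
  intro h
  have : 1 - ‖a‖ ^ 2 = 0 := by exact_mod_cast h
  exact ha (by nlinarith [norm_nonneg a])

/-- Both sides are in normal form at 0, so agreement on a punctured neighbourhood includes the value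
at 0. -/
theorem eventuallyEq_nhds_div {f P Q : ℂ → ℂ} (hf : MeromorphicNFOn f unitDisk)
    (hP : IsBoundedAnalytic P) (hQ : IsBoundedAnalytic Q) (hQ0 : Q 0 ≠ 0)
    (h : f =ᶠ[𝓝[≠] 0] fun z => P z / Q z) : f =ᶠ[𝓝 0] fun z => P z / Q z := by
  refine ((hf zero_mem_unitDisk).eventuallyEq_nhdsNE_iff_eventuallyEq_nhds ?_).1 h
  exact ((hP.1 0 zero_mem_unitDisk).div (hQ.1 0 zero_mem_unitDisk) hQ0).meromorphicNFAt

theorem schurIterate_eventuallyEq {F : ℂ → ℂ} {α : ℕ → ℂ} {P Q : ℕ → ℂ → ℂ}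
    (h0 : ¬ meromorphicOrderAt F 0 < 0) (hα : ∀ n, ‖α n‖ ≠ 1)
    (hPQ : ∀ n, IsBoundedAnalytic (P n) ∧ IsBoundedAnalytic (Q n) ∧
      P n 0 = α n ∧ Q n 0 = 1 ∧ ∀ z ∈ unitDisk,
        (P n z - α n * Q n z) * Q (n + 1) z = z * P (n + 1) z * (Q n z - conj (α n) * P n z))
    (hseed : schurSeed F =ᶠ[𝓝[≠] 0] fun z => P 0 z / Q 0 z) (n : ℕ) :
    schurIterate F n =ᶠ[𝓝 0] fun z => P n z / Q n z := by
  have hQne : ∀ n, ∀ᶠ z in 𝓝 (0 : ℂ), Q n z ≠ 0 := fun n =>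
    ((hPQ n).2.1.1 0 zero_mem_unitDisk).continuousAt.eventually_ne (by simp [(hPQ n).2.2.2.1])
  induction n with
  | zero =>
    exact eventuallyEq_nhds_div (meromorphicNFOn_schurIterate h0 0) (hPQ 0).1 (hPQ 0).2.1
      (by simp [(hPQ 0).2.2.2.1]) hseed
  | succ n ih =>
    refine eventuallyEq_nhds_div (meromorphicNFOn_schurIterate h0 _) (hPQ _).1 (hPQ _).2.1
      (by simp [(hPQ _).2.2.2.1]) ?_
    obtain ⟨hP, hQ, hP0, hQ0, hrel⟩ := hPQ n
    have hval : schurIterate F n 0 = α n := by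
      rw [ih.eq_of_nhds, hP0, hQ0, div_one]
    have hden : ∀ᶠ z in 𝓝 (0 : ℂ), Q n z - conj (α n) * P n z ≠ 0 := by
      have : ContinuousAt (fun z => Q n z - conj (α n) * P n z) 0 :=
        (hQ.1 0 zero_mem_unitDisk).continuousAt.sub
          (continuousAt_const.mul (hP.1 0 zero_mem_unitDisk).continuousAt)
      refine this.eventually_ne ?_
      rw [hP0, hQ0]
      exact one_sub_conj_mul_self_ne_zero (hα n)
    refine (schurStep_eventuallyEq (meromorphicNFOn_schurIterate h0 n).meromorphicOn).trans ?_
    filter_upwards [nhdsWithin_le_nhds ih, nhdsWithin_le_nhds hden,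
      nhdsWithin_le_nhds (hQne n), nhdsWithin_le_nhds (hQne (n + 1)),
      nhdsWithin_le_nhds unitDisk_mem_nhds, self_mem_nhdsWithin] with z hz hd hq hq' hzd hz0
    have hz0' : z ≠ 0 := hz0
    have h1 : (P n z / Q n z - α n) / (1 - conj (α n) * (P n z / Q n z)) =
        (P n z - α n * Q n z) / (Q n z - conj (α n) * P n z) := by
      rw [div_sub' hq, ← mul_div_assoc, one_sub_div hq, div_div_div_cancel_right₀ hq,
        mul_comm (Q n z)]
    rw [hval, hz, h1, eq_div_iff hq', one_div, mul_assoc, div_mul_eq_mul_div, hrel z hzd,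
      mul_div_cancel_right₀ _ hd, inv_mul_cancel_left₀ hz0']

/-- A sequence as in the statement is determined by some pseudo-Carathéodory function. -/
theorem exists_pseudoCaratheodory {α : ℕ → ℂ} {N : ℕ} (h₁ : ∀ n < N, ‖α n‖ ≠ 1)
    (h₂ : ∀ n ≥ N, ‖α n‖ < 1) :
    ∃ F : ℂ → ℂ, IsPseudoCaratheodory F ∧ DeterminesSchurParameters F α := by
  have hα : ∀ n, ‖α n‖ ≠ 1 := fun n => by
    by_cases hn : n < N
    · exact h₁ n hn
    · exact (h₂ n (not_lt.1 hn)).ne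
  obtain ⟨P, Q, hPQ, ε, hε, hb⟩ := exists_schur_fractions N α h₁ h₂
  have hε0 : (ε : ℂ) ≠ 0 := by rcases hε with rfl | rfl <;> simp
  obtain ⟨hP, hQ, hP0, hQ0, -⟩ := hPQ 0
  set g : ℂ → ℂ := fun z => ε * (Q 0 z + z * P 0 z) with hg_def
  set h : ℂ → ℂ := fun z => Q 0 z - z * P 0 z with hh_def
  have hg : IsBoundedAnalytic g :=
    (IsBoundedAnalytic.const _).mul (hQ.add (isBoundedAnalytic_id.mul hP))
  have hh : IsBoundedAnalytic h := hQ.sub (isBoundedAnalytic_id.mul hP)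
  have hh0 : h 0 = 1 := by simp [hh_def, hQ0]
  have hg0 : g 0 = ε := by simp [hg_def, hQ0]
  have hmer : MeromorphicOn (fun z => g z / h z) unitDisk := fun z hz =>
    (hg.1 z hz).meromorphicAt.fun_div (hh.1 z hz).meromorphicAt
  set F := toMeromorphicNFOn (fun z => g z / h z) unitDisk with hF_def
  have hNF : MeromorphicNFOn F unitDisk := meromorphicNFOn_toMeromorphicNFOn _ _
  have hFval : ∀ z ∈ unitDisk, h z ≠ 0 → F z = g z / h z := fun z hz hz0 => by
    rw [hF_def, toMeromorphicNFOn_eq_toMeromorphicNFAt hmer hz,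
      toMeromorphicNFAt_eq_self.2
        (((hg.1 z hz).fun_div (hh.1 z hz) hz0).meromorphicNFAt)]
  have hF0 : F 0 = ε := by
    rw [hFval 0 zero_mem_unitDisk (by simp [hh0]), hg0, hh0, div_one]
  have hhne : ∀ᶠ z in 𝓝 (0 : ℂ), h z ≠ 0 :=
    (hh.1 0 zero_mem_unitDisk).continuousAt.eventually_ne (by simp [hh0])
  have hQne : ∀ᶠ z in 𝓝 (0 : ℂ), Q 0 z ≠ 0 :=
    (hQ.1 0 zero_mem_unitDisk).continuousAt.eventually_ne (by simp [hQ0])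
  have hFan : AnalyticAt ℂ F 0 := by
    refine ((hg.1 0 zero_mem_unitDisk).fun_div (hh.1 0 zero_mem_unitDisk) (by simp [hh0])).congr ?_
    filter_upwards [hhne, unitDisk_mem_nhds] with z hz hzd
    exact (hFval z hzd hz).symm
  have hord : ¬ meromorphicOrderAt F 0 < 0 := not_lt.2 hFan.meromorphicOrderAt_nonneg
  have hseed : schurSeed F =ᶠ[𝓝[≠] 0] fun z => P 0 z / Q 0 z := by
    refine (schurSeed_eventuallyEq hNF.meromorphicOn hord).trans ?_
    filter_upwards [nhdsWithin_le_nhds hhne, nhdsWithin_le_nhds hQne,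
      nhdsWithin_le_nhds unitDisk_mem_nhds, self_mem_nhdsWithin] with z hz hq hzd hz0
    have hz0' : z ≠ 0 := hz0
    rw [hFval z hzd hz, hF0, div_sub' hz, div_add' _ _ _ hz, div_div_div_cancel_right₀ hz]
    have e1 : g z - h z * ε = 2 * ε * (z * P 0 z) := by simp only [hg_def, hh_def]; ring
    have e2 : g z + ε * h z = 2 * ε * Q 0 z := by simp only [hg_def, hh_def]; ring
    rw [e1, e2]
    field_simp
  have hit := schurIterate_eventuallyEq hord hα hPQ hseed
  have hitval : ∀ n, schurIterate F n 0 = α n := fun n => by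
    rw [(hit n).eq_of_nhds, (hPQ n).2.2.1, (hPQ n).2.2.2.1, div_one]
  refine ⟨F, ⟨hNF, ⟨g, h, hg, hh, ⟨0, zero_mem_unitDisk, by simp [hh0]⟩, hFval⟩, ?_⟩,
    ⟨⟨0, zero_mem_unitDisk, ?_⟩, fun n => ⟨0, zero_mem_unitDisk, ?_⟩, fun n => ?_, hitval⟩⟩
  · filter_upwards [hb, ae_not_tendsto_radial_zero hh (by simp [hh0])] with θ ⟨p, q, hp, hq, hpq⟩ hne
    set ζ := Complex.exp (θ * Complex.I)
    have hζ : ‖ζ‖ = 1 := Complex.norm_exp_ofReal_mul_I θ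
    have hz : Tendsto (fun r : ℝ => (r : ℂ) * ζ) (𝓝[<] 1) (𝓝 ζ) := tendsto_radius_mul_exp θ
    have hht : Tendsto (fun r : ℝ => h (r * ζ)) (𝓝[<] 1) (𝓝 (q - ζ * p)) := hq.sub (hz.mul hp)
    have hgt : Tendsto (fun r : ℝ => g (r * ζ)) (𝓝[<] 1) (𝓝 (ε * (q + ζ * p))) :=
      (hq.add (hz.mul hp)).const_mul _
    -- Here the a.e. nonvanishing of the radial limit of `h` is used.
    have hd : q - ζ * p ≠ 0 := fun h0 => hne (h0 ▸ hht)
    refine ⟨ε * (q + ζ * p) / (q - ζ * p), (hgt.div hht hd).congr' ?_, ?_⟩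
    · filter_upwards [hht.eventually_ne hd, eventually_radius_mul_exp_mem_unitDisk θ] with r h0 hr
      exact (hFval _ hr h0).symm
    · have hre : (ε * (q + ζ * p) / (q - ζ * p)).re =
          ε * (‖q‖ ^ 2 - ‖ζ * p‖ ^ 2) / Complex.normSq (q - ζ * p) := by
        rw [mul_div_assoc, Complex.re_ofReal_mul, mul_div_assoc, Complex.div_re, ← add_div]
        congr 2
        simp only [← Complex.normSq_eq_norm_sq, Complex.normSq_apply, Complex.add_re,
          Complex.add_im, Complex.sub_re, Complex.sub_im]
        ring
      rw [hre, norm_mul, hζ, one_mul]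
      exact div_nonneg hpq (Complex.normSq_nonneg _)
  · rw [hF0, ← two_mul]
    exact mul_ne_zero two_ne_zero hε0
  · rw [hitval n]
    exact one_sub_conj_mul_self_ne_zero (hα n)
  · exact (((hPQ n).1.1 0 zero_mem_unitDisk).fun_div ((hPQ n).2.1.1 0 zero_mem_unitDisk)
      (by simp [(hPQ n).2.2.2.1])).congr (hit n).symm

/-! ### Uniqueness -/

/-- Identity theorem: infinite order of the difference spreads over the connected disk, and normal
forms then agree at every point, poles included. -/
theorem eqOn_unitDisk_of_eventuallyEq {F G : ℂ → ℂ} (hF : MeromorphicNFOn F unitDisk)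
    (hG : MeromorphicNFOn G unitDisk) (h : F =ᶠ[𝓝[≠] 0] G) : Set.EqOn F G unitDisk := by
  intro z hz
  have h0 : meromorphicOrderAt (F - G) 0 = ⊤ := by
    rw [meromorphicOrderAt_eq_top_iff]
    filter_upwards [h] with w hw
    simp [hw]
  have hz' : meromorphicOrderAt (F - G) z = ⊤ := by
    by_contra hne
    exact (hF.meromorphicOn.sub hG.meromorphicOn).meromorphicOrderAt_ne_top_of_isPreconnected
      (convex_ball _ _).isPreconnected hz zero_mem_unitDisk hne h0
  rw [meromorphicOrderAt_eq_top_iff] at hz'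
  refine Filter.EventuallyEq.eq_of_nhds
    (((hF hz).eventuallyEq_nhdsNE_iff_eventuallyEq_nhds (hG hz)).1 ?_)
  filter_upwards [hz'] with w hw
  simpa [sub_eq_zero] using hw

/-- Rules out the two degenerate seeds: -1/z when `F` has a pole at 0, and 1/z when `F` vanishes at
0 but not identically. -/
theorem not_analyticAt_zero_of_eventuallyEq_const_div {f : ℂ → ℂ} {c : ℂ} (hc : c ≠ 0)
    (h : f =ᶠ[𝓝[≠] 0] fun z => c / z) : ¬ AnalyticAt ℂ f 0 := by
  intro hf
  have h1 : Tendsto (fun z => z * f z) (𝓝[≠] 0) (𝓝 (0 * f 0)) :=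
    (continuousAt_id.mul hf.continuousAt).tendsto.mono_left nhdsWithin_le_nhds
  have h2 : Tendsto (fun z => z * f z) (𝓝[≠] 0) (𝓝 c) := by
    refine tendsto_const_nhds.congr' ?_
    filter_upwards [h, self_mem_nhdsWithin] with z hz hz0
    have hz0' : z ≠ 0 := hz0
    rw [hz, mul_div_cancel₀ _ hz0']
  exact hc (by simpa using tendsto_nhds_unique h2 h1)

theorem DeterminesSchurParameters.analyticAt_zero {F : ℂ → ℂ} {α : ℕ → ℂ}
    (hF : MeromorphicNFOn F unitDisk) (h : DeterminesSchurParameters F α) : AnalyticAt ℂ F 0 := by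
  rw [← (hF zero_mem_unitDisk).meromorphicOrderAt_nonneg_iff_analyticAt]
  by_contra hord
  refine not_analyticAt_zero_of_eventuallyEq_const_div (neg_ne_zero.2 one_ne_zero) ?_ (h.not_pole 0)
  rw [schurIterate, schurSeed, if_pos (not_le.1 hord)]

theorem DeterminesSchurParameters.apply_zero_ne_zero {F : ℂ → ℂ} {α : ℕ → ℂ}
    (hF : MeromorphicNFOn F unitDisk) (h : DeterminesSchurParameters F α) : F 0 ≠ 0 := by
  intro h0
  have hord : ¬ meromorphicOrderAt F 0 < 0 :=
    not_lt.2 (h.analyticAt_zero hF).meromorphicOrderAt_nonneg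
  rcases (hF zero_mem_unitDisk).meromorphicAt.eventually_eq_zero_or_eventually_ne_zero with he | he
  · obtain ⟨z, hz, hne⟩ := h.seed_defined
    have hzero : MeromorphicNFOn (fun _ : ℂ => (0 : ℂ)) unitDisk :=
      analyticOnNhd_const.meromorphicNFOn
    exact hne (by rw [h0, eqOn_unitDisk_of_eventuallyEq hF hzero he hz, add_zero])
  · refine not_analyticAt_zero_of_eventuallyEq_const_div one_ne_zero ?_ (h.not_pole 0)
    refine (schurSeed_eventuallyEq hF.meromorphicOn hord).trans ?_
    filter_upwards [he] with z hz
    rw [h0, sub_zero, add_zero, div_self hz, mul_one]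

theorem DeterminesSchurParameters.seed_relation {F : ℂ → ℂ} {α : ℕ → ℂ}
    (hF : MeromorphicNFOn F unitDisk) (h : DeterminesSchurParameters F α) :
    ∀ᶠ z in 𝓝[≠] 0, F z * (1 - z * schurIterate F 0 z) = F 0 * (1 + z * schurIterate F 0 z) := by
  have hana := h.analyticAt_zero hF
  have hord : ¬ meromorphicOrderAt F 0 < 0 := not_lt.2 hana.meromorphicOrderAt_nonneg
  have hne : ∀ᶠ z in 𝓝 0, F z + F 0 ≠ 0 := by
    refine (hana.continuousAt.add continuousAt_const).eventually_ne ?_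
    rw [Pi.add_apply, ← two_mul]
    exact mul_ne_zero two_ne_zero (h.apply_zero_ne_zero hF)
  filter_upwards [schurSeed_eventuallyEq hF.meromorphicOn hord, nhdsWithin_le_nhds hne,
    self_mem_nhdsWithin] with z hz hd hz0
  have hz0' : z ≠ 0 := hz0
  rw [schurIterate, hz]
  field_simp
  ring

/-- Cleared of denominators, the recursion holds at 0 too, since both sides vanish there. -/
theorem DeterminesSchurParameters.step_relation {F : ℂ → ℂ} {α : ℕ → ℂ}
    (hF : MeromorphicNFOn F unitDisk) (h : DeterminesSchurParameters F α) (hα : ∀ n, ‖α n‖ ≠ 1)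
    (n : ℕ) : ∀ᶠ z in 𝓝 0, z * schurIterate F (n + 1) z * (1 - conj (α n) * schurIterate F n z) =
      schurIterate F n z - α n := by
  have hord : ¬ meromorphicOrderAt F 0 < 0 :=
    not_lt.2 (h.analyticAt_zero hF).meromorphicOrderAt_nonneg
  have hne : ∀ᶠ z in 𝓝 0, 1 - conj (α n) * schurIterate F n z ≠ 0 := by
    refine (continuousAt_const.sub
      (continuousAt_const.mul (h.not_pole n).continuousAt)).eventually_ne ?_
    rw [Pi.sub_apply, Pi.mul_apply, h.value n]
    exact one_sub_conj_mul_self_ne_zero (hα n)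
  have hst := schurStep_eventuallyEq (meromorphicNFOn_schurIterate hord n).meromorphicOn
  rw [Filter.EventuallyEq, eventually_nhdsWithin_iff] at hst
  filter_upwards [hst, hne] with z hz hd
  rcases eq_or_ne z 0 with rfl | hz0
  · rw [h.value n]
    ring
  · rw [schurIterate, hz hz0, h.value n, ← mul_assoc, mul_one_div_cancel hz0, one_mul,
      div_mul_cancel₀ _ hd]

theorem DeterminesSchurParameters.schurIterate_eventuallyEq {F G : ℂ → ℂ} {α : ℕ → ℂ}
    (hF : MeromorphicNFOn F unitDisk) (hG : MeromorphicNFOn G unitDisk)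
    (hFα : DeterminesSchurParameters F α) (hGα : DeterminesSchurParameters G α)
    (hα : ∀ n, ‖α n‖ ≠ 1) (n : ℕ) : schurIterate F n =ᶠ[𝓝 0] schurIterate G n := by
  set d : ℕ → ℂ → ℂ := fun n => schurIterate F n - schurIterate G n
  have hd : ∀ n, AnalyticAt ℂ (d n) 0 := fun n => (hFα.not_pole n).sub (hGα.not_pole n)
  have hstep : ∀ n, 1 + analyticOrderAt (d (n + 1)) 0 ≤ analyticOrderAt (d n) 0 := by
    intro n
    have hf' := hFα.not_pole (n + 1)
    have hg := hGα.not_pole n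
    set u : ℂ → ℂ := fun z => 1 + conj (α n) * (z * schurIterate F (n + 1) z)
    set v : ℂ → ℂ := fun z => 1 - conj (α n) * schurIterate G n z
    have hu : AnalyticAt ℂ u 0 := by fun_prop
    have hv : AnalyticAt ℂ v 0 := by fun_prop
    have hid : AnalyticAt ℂ (fun z : ℂ => z) 0 := analyticAt_id
    -- Mixing the iterate n + 1 of `F` in `u` with the iterate n of `G` in `v` makes the difference
    -- factor exactly. As `u` is 1 at 0, it does not change the order.
    have heq : d n * u =ᶠ[𝓝 0] (fun z : ℂ => z) * d (n + 1) * v := by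
      filter_upwards [hFα.step_relation hF hα n, hGα.step_relation hG hα n] with z h1 h2
      simp only [Pi.mul_apply, Pi.sub_apply, d, u, v]
      linear_combination h2 - h1
    have hu0 : analyticOrderAt u 0 = 0 := by
      rw [hu.analyticOrderAt_eq_zero]
      simp [u]
    have hid1 : 1 ≤ analyticOrderAt (fun z : ℂ => z) 0 := by
      rw [Order.one_le_iff_ne_zero, Ne, hid.analyticOrderAt_eq_zero]
      simp
    have := analyticOrderAt_congr heq
    rw [analyticOrderAt_mul (hd n) hu, analyticOrderAt_mul (hid.mul (hd (n + 1))) hv,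
      analyticOrderAt_mul hid (hd (n + 1)), hu0, add_zero] at this
    rw [this]
    exact le_add_right (by gcongr)
  -- The bound is proved for all n at once, since each gain in order refers to the next index.
  have hle : ∀ k : ℕ, ∀ n, (k : ℕ∞) ≤ analyticOrderAt (d n) 0 := by
    intro k
    induction k with
    | zero => simp
    | succ k ih =>
      intro n
      refine le_trans ?_ (hstep n)
      rw [Nat.cast_succ, add_comm]
      gcongr
      exact ih (n + 1)
  have htop : analyticOrderAt (d n) 0 = ⊤ := ENat.eq_top_iff_forall_ge.2 fun k => hle k n
  filter_upwards [analyticOrderAt_eq_top.1 htop] with z hz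
  simpa [d, sub_eq_zero] using hz

/-- The parameters determine the function up to a scalar factor. -/
theorem DeterminesSchurParameters.eq_const_mul {F G : ℂ → ℂ} {α : ℕ → ℂ}
    (hF : MeromorphicNFOn F unitDisk) (hG : MeromorphicNFOn G unitDisk)
    (hFα : DeterminesSchurParameters F α) (hGα : DeterminesSchurParameters G α)
    (hα : ∀ n, ‖α n‖ ≠ 1) : ∃ c : ℂ, ∀ z ∈ unitDisk, G z = c * F z := by
  have hF0 := hFα.apply_zero_ne_zero hF
  have hG0 := hGα.apply_zero_ne_zero hG
  have hc0 : G 0 / F 0 ≠ 0 := div_ne_zero hG0 hF0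
  have hNF : MeromorphicNFOn ((fun _ => G 0 / F 0) * F) unitDisk :=
    (meromorphicNFOn_mul_iff_right_of_analyticOnNhd analyticOnNhd_const fun _ _ => hc0).2 hF
  refine ⟨G 0 / F 0, eqOn_unitDisk_of_eventuallyEq hG hNF ?_⟩
  have hne : ∀ᶠ z in 𝓝 0, 1 - z * schurIterate F 0 z ≠ 0 := by
    refine (continuousAt_const.sub
      (continuousAt_id.mul (hFα.not_pole 0).continuousAt)).eventually_ne ?_
    simp
  filter_upwards [hFα.seed_relation hF, hGα.seed_relation hG, nhdsWithin_le_nhds hne,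
    nhdsWithin_le_nhds (hFα.schurIterate_eventuallyEq hF hG hGα hα 0)] with z h1 h2 h3 h4
  rw [← h4] at h2
  refine mul_right_cancel₀ h3 ?_
  rw [h2, mul_assoc, h1, ← mul_assoc, div_mul_cancel₀ _ hF0]

theorem theorem5 (α : ℕ → ℂ)
    (hα : ∃ N : ℕ, (∀ n < N, ‖α n‖ ≠ 1) ∧ ∀ n ≥ N, ‖α n‖ < 1) :
    ∃ F : ℂ → ℂ, IsPseudoCaratheodory F ∧ DeterminesSchurParameters F α ∧
      ∀ G : ℂ → ℂ, IsPseudoCaratheodory G → DeterminesSchurParameters G α →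
        ∃ c : ℂ, ∀ z ∈ unitDisk, G z = c * F z := by
  obtain ⟨N, h₁, h₂⟩ := hα
  have hne : ∀ n, ‖α n‖ ≠ 1 := fun n => by
    by_cases hn : n < N
    · exact h₁ n hn
    · exact (h₂ n (not_lt.1 hn)).ne
  obtain ⟨F, hF, hFα⟩ := exists_pseudoCaratheodory h₁ h₂
  exact ⟨F, hF, hFα, fun G hG hGα =>
    hFα.eq_const_mul hF.meromorphicNFOn hG.meromorphicNFOn hGα hne⟩
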